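/- Let $\Phi$ be a commutative unital ring and let $A=(A^+,A^-)$ be an associative pair over $\Phi$, that is, a pair of $\Phi$-modules with trilinear products $A^\sigma\times A^{-\sigma}\times A^\sigma\to A^\sigma$, $(x,y,z)\mapsto xyz$, satisfying $(xyz)st=x(yzs)t=xy(zst)$ for $\sigma=\pm$. The standard imbedding of $A$ is the unital associative $\Phi$-algebra ${\cal E}={\cal E}_{11}\oplus A^+\oplus A^-\oplus{\cal E}_{22}$, where ${\cal E}_{11}$ is the unital subalgebra of $End_\Phi(A^+)\times End_\Phi(A^-)^{op}$ generated by all elements $xy:=(z\mapsto xyz,\ w\mapsto wxy)$ with $x,z\in A^+$, $y,w\in A^-$, where ${\cal E}_{22}$ is defined in the same way with the roles of $A^+$ and $A^-$ exchanged, and where the multiplication is that of $2\times 2$ matrices $\begin{pmatrix}{\cal E}_{11}&A^+\\A^-&{\cal E}_{22}\end{pmatrix}$ with the natural actions. Call $A$ strongly primitive if * its socle is nonzero, i.e. at least one of $Soc(A^+)$, $Soc(A^-)$ is nonzero, where $Soc(A^\sigma)$ is the sum of all minimal right ideals of $A$ contained in $A^\sigma$ (a right ideal is a $\Phi$-submodule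 $R\subseteq A^\sigma$ with $RA^{-\sigma}A^\sigma\subseteq R$); and * there are an associative division $\Phi$-algebra $\Delta$ which is PI and right $\Delta$-vector spaces $M^+,M^-$ such that $A$ is isomorphic to a dense subpair of $\left(Hom_\Delta(M^-,M^+),Hom_\Delta(M^+,M^-)\right)$, the products being given by composition. Here dense means that for each $\sigma=\pm$, any $\Delta$-linearly independent $m_1,\dots,m_n\in M^{-\sigma}$ and any $m_1',\dots,m_n'\in M^{\sigma}$, there is $a\in A^\sigma$ with $a(m_i)=m_i'$ for all $i$. Call a unital associative $\Phi$-algebra $R$ strongly primitive if its socle (the sum of all minimal right ideals of $R$) is nonzero and $R$ is isomorphic to a dense subalgebra of $End_\Delta(M)$ for some right vector space $M$ over an associative division PI-algebra $\Delta$ over $\Phi$, with density defined as above. (A $\Phi$-algebra is PI if it satisfies a polynomial identity $f$ with coefficients in $\Phi$ in noncommuting variables such that some monomial of maximal degree in $f$ has coefficient $1$. Vector spaces over $\Delta$ carry a compatible $\Phi$-module structure.) **Theorem.** Let $A$ be an associative pair. Then $A$ is strongly primitive if and only if its standard imbedding ${\cal E}$ is strongly primitive. -/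

import Mathlib

universe u v w

/-- An associative pair `(P, N) = (A⁺, A⁻)` over `Φ`: two `Φ`-modules with trilinear products
`A⁺ × A⁻ × A⁺ → A⁺` and `A⁻ × A⁺ × A⁻ → A⁻` such that
`(xyz)st = x(yzs)t = xy(zst)` for `x, z, t ∈ A^σ` and `y, s ∈ A^{-σ}`, `σ = ±`. -/
structure AssociativePair (Φ : Type w) [CommRing Φ] (P : Type u) (N : Type v)
    [AddCommGroup P] [Module Φ P] [AddCommGroup N] [Module Φ N] where
  pos : P →ₗ[Φ] N →ₗ[Φ] P →ₗ[Φ] P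
  neg : N →ₗ[Φ] P →ₗ[Φ] N →ₗ[Φ] N
  pos_assoc_left : ∀ x y z s t, pos (pos x y z) s t = pos x (neg y z s) t
  pos_assoc_right : ∀ x y z s t, pos x (neg y z s) t = pos x y (pos z s t)
  neg_assoc_left : ∀ x y z s t, neg (neg x y z) s t = neg x (pos y z s) t
  neg_assoc_right : ∀ x y z s t, neg x (pos y z s) t = neg x y (neg z s t)

namespace AssociativePair

section Basic

variable {Φ : Type w} [CommRing Φ] {P : Type u} {N : Type v}
  [AddCommGroup P] [Module Φ P] [AddCommGroup N] [Module Φ N]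

/-- The pair `(A⁻, A⁺)`. -/
def swap (A : AssociativePair Φ P N) : AssociativePair Φ N P where
  pos := A.neg
  neg := A.pos
  pos_assoc_left := A.neg_assoc_left
  pos_assoc_right := A.neg_assoc_right
  neg_assoc_left := A.pos_assoc_left
  neg_assoc_right := A.pos_assoc_right

/-- A right ideal of the pair `A` inside `A⁺`: a submodule `R` with `R A⁻ A⁺ ⊆ R`. -/
def IsRightIdeal (A : AssociativePair Φ P N) (R : Submodule Φ P) : Prop :=
  ∀ r ∈ R, ∀ (y : N) (z : P), A.pos r y z ∈ R

/-- A minimal right ideal of the pair `A` inside `A⁺`. -/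
def IsMinimalRightIdeal (A : AssociativePair Φ P N) (R : Submodule Φ P) : Prop :=
  Minimal (fun R => A.IsRightIdeal R ∧ R ≠ ⊥) R

/-- `Soc(A⁺)`, the sum of all minimal right ideals of `A` contained in `A⁺`. -/
def socPos (A : AssociativePair Φ P N) : Submodule Φ P :=
  sSup {R | A.IsMinimalRightIdeal R}

/-- `Soc(A⁻)`, the sum of all minimal right ideals of `A` contained in `A⁻`. -/
def socNeg (A : AssociativePair Φ P N) : Submodule Φ N :=
  A.swap.socPos

/-- The element `xy = (z ↦ xyz, w ↦ wxy)` of `End(A⁺) × End(A⁻)ᵒᵖ`, for `x ∈ A⁺`, `y ∈ A⁻`. -/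
def prodEnd (A : AssociativePair Φ P N) (x : P) (y : N) :
    Module.End Φ P × (Module.End Φ N)ᵐᵒᵖ :=
  (A.pos x y, MulOpposite.op ((A.neg.flip x).flip y))

/-- The Peirce space `E₁₁` of the standard imbedding: the unital subalgebra of
`End(A⁺) × End(A⁻)ᵒᵖ` generated by all elements `xy`. The space `E₂₂` is `A.swap.diag`. -/
def diag (A : AssociativePair Φ P N) :
    Subalgebra Φ (Module.End Φ P × (Module.End Φ N)ᵐᵒᵖ) :=
  Algebra.adjoin Φ {a | ∃ x y, a = A.prodEnd x y}

/-- The element `xy` of `E₁₁`. -/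
def prod (A : AssociativePair Φ P N) (x : P) (y : N) : A.diag :=
  ⟨A.prodEnd x y, Algebra.subset_adjoin ⟨x, y, rfl⟩⟩

/-- The left action of `E₁₁` on `A⁺ = E₁₂`. -/
def lact (A : AssociativePair Φ P N) (a : A.diag) (x : P) : P := a.1.1 x

/-- The right action of `E₁₁` on `A⁻ = E₂₁`. -/
def ract (A : AssociativePair Φ P N) (y : N) (a : A.diag) : N := a.1.2.unop y

section Lemmas

variable (A : AssociativePair Φ P N)

theorem diag_induction {p : Module.End Φ P × (Module.End Φ N)ᵐᵒᵖ → Prop}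
    (hx : ∀ x y, p (A.prodEnd x y)) (hr : ∀ r : Φ, p (algebraMap Φ _ r))
    (ha : ∀ a b, p a → p b → p (a + b)) (hm : ∀ a b, p a → p b → p (a * b))
    (a : A.diag) : p a.1 := by
  obtain ⟨a, h⟩ := a
  unfold diag at h
  induction h using Algebra.adjoin_induction with
  | mem x hx' => obtain ⟨x, y, rfl⟩ := hx'; exact hx x y
  | algebraMap r => exact hr r
  | add a b _ _ h1 h2 => exact ha a b h1 h2
  | mul a b _ _ h1 h2 => exact hm a b h1 h2

theorem lact_pos (a : A.diag) (x : P) (y : N) (z : P) :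
    A.lact a (A.pos x y z) = A.pos (A.lact a x) y z := by
  refine A.diag_induction (p := fun a => ∀ x, a.1 (A.pos x y z) = A.pos (a.1 x) y z)
    ?_ ?_ ?_ ?_ a x
  · intro s t x
    simp [prodEnd, A.pos_assoc_left, A.pos_assoc_right]
  · intro r x
    simp [Module.algebraMap_end_apply]
  · intro a b ha hb x
    simp [ha, hb]
  · intro a b ha hb x
    simp [ha, hb]

theorem neg_lact (a : A.diag) (t : N) (x : P) (y : N) :
    A.neg t (A.lact a x) y = A.neg (A.ract t a) x y := by
  refine A.diag_induction (p := fun a => ∀ t x, A.neg t (a.1 x) y = A.neg (a.2.unop t) x y)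
    ?_ ?_ ?_ ?_ a t x
  · intro s r t x
    simp [prodEnd, A.neg_assoc_left]
  · intro r t x
    simp [Module.algebraMap_end_apply]
  · intro a b ha hb t x
    simp [ha, hb]
  · intro a b ha hb t x
    simp [ha, hb]

theorem ract_neg (a : A.diag) (t : N) (x : P) (y : N) :
    A.ract (A.neg t x y) a = A.neg t x (A.ract y a) := by
  refine A.diag_induction
    (p := fun a => ∀ y, a.2.unop (A.neg t x y) = A.neg t x (a.2.unop y)) ?_ ?_ ?_ ?_ a y
  · intro s r y
    simp [prodEnd, A.neg_assoc_left, A.neg_assoc_right]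
  · intro r y
    simp [Module.algebraMap_end_apply]
  · intro a b ha hb y
    simp [ha, hb]
  · intro a b ha hb y
    simp [ha, hb]

theorem pos_ract (a : A.diag) (x : P) (y : N) (z : P) :
    A.pos x (A.ract y a) z = A.pos x y (A.lact a z) := by
  refine A.diag_induction
    (p := fun a => ∀ y z, A.pos x (a.2.unop y) z = A.pos x y (a.1 z)) ?_ ?_ ?_ ?_ a y z
  · intro s r y z
    simp [prodEnd, A.pos_assoc_right]
  · intro r y z
    simp [Module.algebraMap_end_apply]
  · intro a b ha hb y z
    simp [ha, hb]
  · intro a b ha hb y z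
    simp [ha, hb]

theorem lact_ract_comm (a : A.diag) (b : A.swap.diag) (x : P) :
    A.swap.ract (A.lact a x) b = A.lact a (A.swap.ract x b) := by
  refine A.diag_induction
    (p := fun a => ∀ x, b.1.2.unop (a.1 x) = a.1 (b.1.2.unop x)) ?_ ?_ ?_ ?_ a x
  · intro s r x
    exact A.swap.ract_neg b s r x
  · intro r x
    simp [Module.algebraMap_end_apply]
  · intro a b ha hb x
    simp [ha, hb]
  · intro a b ha hb x
    simp [ha, hb]

theorem prod_lact (a : A.diag) (x : P) (y : N) :
    A.prod (A.lact a x) y = a * A.prod x y := by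
  apply Subtype.ext
  refine Prod.ext ?_ (MulOpposite.unop_injective ?_)
  · ext z
    exact (A.lact_pos a x y z).symm
  · ext t
    exact A.neg_lact a t x y

theorem prod_ract (a : A.diag) (x : P) (y : N) :
    A.prod x (A.ract y a) = A.prod x y * a := by
  apply Subtype.ext
  refine Prod.ext ?_ (MulOpposite.unop_injective ?_)
  · ext z
    exact A.pos_ract a x y z
  · ext t
    exact (A.ract_neg a t x y).symm

theorem prod_swap_ract (b : A.swap.diag) (x : P) (y : N) :
    A.prod (A.swap.ract x b) y = A.prod x (A.swap.lact b y) := by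
  apply Subtype.ext
  refine Prod.ext ?_ (MulOpposite.unop_injective ?_)
  · ext z
    exact (A.swap.neg_lact b x y z).symm
  · ext t
    exact A.swap.pos_ract b t x y

theorem lact_prod (x : P) (y : N) (z : P) :
    A.lact (A.prod x y) z = A.swap.ract x (A.swap.prod y z) := rfl

theorem lact_mul (a b : A.diag) (x : P) : A.lact (a * b) x = A.lact a (A.lact b x) := rfl
theorem ract_mul (a b : A.diag) (y : N) : A.ract y (a * b) = A.ract (A.ract y a) b := rfl
theorem lact_one (x : P) : A.lact 1 x = x := rfl
theorem ract_one (y : N) : A.ract y 1 = y := rfl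
theorem lact_add (a : A.diag) (x x' : P) : A.lact a (x + x') = A.lact a x + A.lact a x' :=
  map_add _ _ _
theorem ract_add (a : A.diag) (y y' : N) : A.ract (y + y') a = A.ract y a + A.ract y' a :=
  map_add _ _ _
theorem add_lact (a b : A.diag) (x : P) : A.lact (a + b) x = A.lact a x + A.lact b x := rfl
theorem add_ract (a b : A.diag) (y : N) : A.ract y (a + b) = A.ract y a + A.ract y b := rfl
theorem lact_zero (a : A.diag) : A.lact a 0 = 0 := map_zero _
theorem ract_zero (a : A.diag) : A.ract 0 a = 0 := map_zero _
theorem zero_lact (x : P) : A.lact 0 x = 0 := rfl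
theorem zero_ract (y : N) : A.ract y 0 = 0 := rfl
theorem lact_smul (r : Φ) (a : A.diag) (x : P) : A.lact a (r • x) = r • A.lact a x :=
  map_smul _ _ _
theorem ract_smul (r : Φ) (a : A.diag) (y : N) : A.ract (r • y) a = r • A.ract y a :=
  map_smul _ _ _
theorem smul_lact (r : Φ) (a : A.diag) (x : P) : A.lact (r • a) x = r • A.lact a x := rfl
theorem smul_ract (r : Φ) (a : A.diag) (y : N) : A.ract y (r • a) = r • A.ract y a := rfl

theorem prod_add (x : P) (y y' : N) : A.prod x (y + y') = A.prod x y + A.prod x y' := by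
  apply Subtype.ext
  refine Prod.ext ?_ (MulOpposite.unop_injective ?_) <;> ext <;> simp [prod, prodEnd]
theorem add_prod (x x' : P) (y : N) : A.prod (x + x') y = A.prod x y + A.prod x' y := by
  apply Subtype.ext
  refine Prod.ext ?_ (MulOpposite.unop_injective ?_) <;> ext <;> simp [prod, prodEnd]
theorem prod_smul (r : Φ) (x : P) (y : N) : A.prod x (r • y) = r • A.prod x y := by
  apply Subtype.ext
  refine Prod.ext ?_ (MulOpposite.unop_injective ?_) <;> ext <;> simp [prod, prodEnd]
theorem smul_prod (r : Φ) (x : P) (y : N) : A.prod (r • x) y = r • A.prod x y := by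
  apply Subtype.ext
  refine Prod.ext ?_ (MulOpposite.unop_injective ?_) <;> ext <;> simp [prod, prodEnd]
theorem prod_zero (x : P) : A.prod x 0 = 0 := by
  simpa using A.prod_smul (0 : Φ) x 0
theorem zero_prod (y : N) : A.prod 0 y = 0 := by
  simpa using A.smul_prod (0 : Φ) 0 y

end Lemmas

/-- The standard imbedding `E = E₁₁ ⊕ A⁺ ⊕ A⁻ ⊕ E₂₂` of an associative pair. -/
@[ext]
structure StandardImbedding (A : AssociativePair Φ P N) where
  c11 : A.diag
  c12 : P
  c21 : N
  c22 : A.swap.diag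

namespace StandardImbedding

variable {A : AssociativePair Φ P N}

instance : Zero A.StandardImbedding := ⟨⟨0, 0, 0, 0⟩⟩
instance : One A.StandardImbedding := ⟨⟨1, 0, 0, 1⟩⟩
instance : Add A.StandardImbedding :=
  ⟨fun a b => ⟨a.c11 + b.c11, a.c12 + b.c12, a.c21 + b.c21, a.c22 + b.c22⟩⟩
instance : Neg A.StandardImbedding := ⟨fun a => ⟨-a.c11, -a.c12, -a.c21, -a.c22⟩⟩
instance : SMul Φ A.StandardImbedding :=
  ⟨fun r a => ⟨r • a.c11, r • a.c12, r • a.c21, r • a.c22⟩⟩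

/-- Multiplication of `2 × 2` matrices. -/
instance : Mul A.StandardImbedding :=
  ⟨fun a b =>
    { c11 := a.c11 * b.c11 + A.prod a.c12 b.c21
      c12 := A.lact a.c11 b.c12 + A.swap.ract a.c12 b.c22
      c21 := A.ract a.c21 b.c11 + A.swap.lact a.c22 b.c21
      c22 := A.swap.prod a.c21 b.c12 + a.c22 * b.c22 }⟩

section Simp

variable (a b : A.StandardImbedding) (r : Φ)

@[simp] theorem zero_c11 : (0 : A.StandardImbedding).c11 = 0 := rfl
@[simp] theorem zero_c12 : (0 : A.StandardImbedding).c12 = 0 := rfl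
@[simp] theorem zero_c21 : (0 : A.StandardImbedding).c21 = 0 := rfl
@[simp] theorem zero_c22 : (0 : A.StandardImbedding).c22 = 0 := rfl
@[simp] theorem one_c11 : (1 : A.StandardImbedding).c11 = 1 := rfl
@[simp] theorem one_c12 : (1 : A.StandardImbedding).c12 = 0 := rfl
@[simp] theorem one_c21 : (1 : A.StandardImbedding).c21 = 0 := rfl
@[simp] theorem one_c22 : (1 : A.StandardImbedding).c22 = 1 := rfl
@[simp] theorem add_c11 : (a + b).c11 = a.c11 + b.c11 := rfl
@[simp] theorem add_c12 : (a + b).c12 = a.c12 + b.c12 := rfl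
@[simp] theorem add_c21 : (a + b).c21 = a.c21 + b.c21 := rfl
@[simp] theorem add_c22 : (a + b).c22 = a.c22 + b.c22 := rfl
@[simp] theorem neg_c11 : (-a).c11 = -a.c11 := rfl
@[simp] theorem neg_c12 : (-a).c12 = -a.c12 := rfl
@[simp] theorem neg_c21 : (-a).c21 = -a.c21 := rfl
@[simp] theorem neg_c22 : (-a).c22 = -a.c22 := rfl
@[simp] theorem smul_c11 : (r • a).c11 = r • a.c11 := rfl
@[simp] theorem smul_c12 : (r • a).c12 = r • a.c12 := rfl
@[simp] theorem smul_c21 : (r • a).c21 = r • a.c21 := rfl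
@[simp] theorem smul_c22 : (r • a).c22 = r • a.c22 := rfl
@[simp] theorem mul_c11 : (a * b).c11 = a.c11 * b.c11 + A.prod a.c12 b.c21 := rfl
@[simp] theorem mul_c12 :
    (a * b).c12 = A.lact a.c11 b.c12 + A.swap.ract a.c12 b.c22 := rfl
@[simp] theorem mul_c21 :
    (a * b).c21 = A.ract a.c21 b.c11 + A.swap.lact a.c22 b.c21 := rfl
@[simp] theorem mul_c22 : (a * b).c22 = A.swap.prod a.c21 b.c12 + a.c22 * b.c22 := rfl

end Simp

theorem mul_assoc' (a b c : A.StandardImbedding) : a * b * c = a * (b * c) := by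
  have h1 : ∀ (b : A.swap.diag) (x : N) (y : P),
      A.swap.prod x (A.swap.ract y b) = A.swap.prod x y * b :=
    fun b x y => A.swap.prod_ract b x y
  have h2 : ∀ (a : A.diag) (x : N) (y : P),
      A.swap.prod (A.ract x a) y = A.swap.prod x (A.lact a y) :=
    fun a x y => A.swap.prod_swap_ract a x y
  have h3 : ∀ (x : N) (y : P) (z : N),
      A.swap.lact (A.swap.prod x y) z = A.ract x (A.prod y z) := fun _ _ _ => rfl
  have h4 : ∀ (b : A.swap.diag) (a : A.diag) (x : N),
      A.ract (A.swap.lact b x) a = A.swap.lact b (A.ract x a) :=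
    fun b a x => A.swap.lact_ract_comm b a x
  ext1
  · simp only [mul_c11, mul_c12, mul_c21, add_mul, mul_add, add_prod, prod_add, prod_lact,
      prod_ract, prod_swap_ract, mul_assoc]
    abel
  · simp only [mul_c11, mul_c12, mul_c22, add_lact, lact_add, ract_add, add_ract, lact_mul,
      ract_mul, lact_prod, lact_ract_comm]
    abel
  · simp only [mul_c11, mul_c21, mul_c22, add_lact, lact_add, ract_add, add_ract, lact_mul,
      ract_mul, h3, h4]
    abel
  · simp only [mul_c12, mul_c21, mul_c22, add_mul, mul_add, add_prod, prod_add, prod_lact,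
      h1, h2, mul_assoc]
    abel

instance : Ring A.StandardImbedding where
  add_assoc a b c := by ext1 <;> simp [add_assoc]
  zero_add a := by ext1 <;> simp
  add_zero a := by ext1 <;> simp
  add_comm a b := by ext1 <;> simp [add_comm]
  neg_add_cancel a := by ext1 <;> simp
  nsmul := nsmulRec
  zsmul := zsmulRec
  left_distrib a b c := by
    ext1 <;> simp [mul_add, prod_add, lact_add, add_ract] <;> abel
  right_distrib a b c := by
    ext1 <;> simp [add_mul, add_prod, add_lact, ract_add] <;> abel
  zero_mul a := by ext1 <;> simp [zero_prod, zero_lact, ract_zero]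
  mul_zero a := by ext1 <;> simp [prod_zero, lact_zero, zero_ract]
  one_mul a := by ext1 <;> simp [zero_prod, lact_one, ract_zero]
  mul_one a := by ext1 <;> simp [prod_zero, lact_zero, ract_one]
  mul_assoc := mul_assoc'

instance : Module Φ A.StandardImbedding where
  one_smul a := by ext1 <;> simp
  mul_smul r s a := by ext1 <;> simp [mul_smul]
  smul_zero r := by ext1 <;> simp
  smul_add r a b := by ext1 <;> simp
  add_smul r s a := by ext1 <;> simp [add_smul]
  zero_smul a := by ext1 <;> simp

instance : Algebra Φ A.StandardImbedding :=
  Algebra.ofModule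
    (fun r a b => by
      ext1 <;> simp [smul_prod, smul_lact, ract_smul])
    (fun r a b => by
      ext1 <;> simp [prod_smul, lact_smul, smul_ract])

end StandardImbedding

end Basic

/-- The associative pair `(Hom_Δ(M⁻, M⁺), Hom_Δ(M⁺, M⁻))` of two right vector spaces over `Δ`,
with the products `abc = a ∘ b ∘ c`. -/
def homPair (Φ : Type w) [CommRing Φ] (Δ : Type u) [DivisionRing Δ] [Algebra Φ Δ]
    (Mp Mm : Type u) [AddCommGroup Mp] [Module Φ Mp] [Module Δᵐᵒᵖ Mp] [IsScalarTower Φ Δᵐᵒᵖ Mp]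
    [AddCommGroup Mm] [Module Φ Mm] [Module Δᵐᵒᵖ Mm] [IsScalarTower Φ Δᵐᵒᵖ Mm] :
    AssociativePair Φ (Mm →ₗ[Δᵐᵒᵖ] Mp) (Mp →ₗ[Δᵐᵒᵖ] Mm) where
  pos := LinearMap.mk₂ Φ
    (fun a b =>
      { toFun := fun c => a ∘ₗ b ∘ₗ c
        map_add' := fun c c' => by ext; simp
        map_smul' := fun r c => by
          ext; simp [LinearMap.map_smul_of_tower] })
    (fun a a' b => by ext; simp)
    (fun r a b => by ext; simp)
    (fun a b b' => by ext; simp)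
    (fun r a b => by ext; simp [LinearMap.map_smul_of_tower])
  neg := LinearMap.mk₂ Φ
    (fun a b =>
      { toFun := fun c => a ∘ₗ b ∘ₗ c
        map_add' := fun c c' => by ext; simp
        map_smul' := fun r c => by
          ext; simp [LinearMap.map_smul_of_tower] })
    (fun a a' b => by ext; simp)
    (fun r a b => by ext; simp)
    (fun a b b' => by ext; simp)
    (fun r a b => by ext; simp [LinearMap.map_smul_of_tower])
  pos_assoc_left _ _ _ _ _ := rfl
  pos_assoc_right _ _ _ _ _ := rfl
  neg_assoc_left _ _ _ _ _ := rfl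
  neg_assoc_right _ _ _ _ _ := rfl

/-- Homomorphisms of associative pairs. -/
structure Hom {Φ : Type w} [CommRing Φ] {P N P' N' : Type*}
    [AddCommGroup P] [Module Φ P] [AddCommGroup N] [Module Φ N]
    [AddCommGroup P'] [Module Φ P'] [AddCommGroup N'] [Module Φ N']
    (A : AssociativePair Φ P N) (B : AssociativePair Φ P' N') where
  toPos : P →ₗ[Φ] P'
  toNeg : N →ₗ[Φ] N'
  map_pos : ∀ x y z, toPos (A.pos x y z) = B.pos (toPos x) (toNeg y) (toPos z)
  map_neg : ∀ x y z, toNeg (A.neg x y z) = B.neg (toNeg x) (toPos y) (toNeg z)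

end AssociativePair

/-- A `Φ`-algebra `R` is PI if some polynomial in the free associative algebra, having a
monomial of maximal degree with coefficient `1`, vanishes under all substitutions from `R`. -/
def IsPIAlgebra (Φ : Type w) [CommRing Φ] (R : Type u) [Ring R] [Algebra Φ R] : Prop :=
  ∃ f : FreeAlgebra Φ ℕ,
    (∃ m : FreeMonoid ℕ, (FreeAlgebra.equivMonoidAlgebraFreeMonoid f).coeff m = 1 ∧
      ∀ m' : FreeMonoid ℕ, (FreeAlgebra.equivMonoidAlgebraFreeMonoid f).coeff m' ≠ 0 →
        m'.length ≤ m.length) ∧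
    ∀ x : ℕ → R, FreeAlgebra.lift Φ x f = 0

/-- Density of a set `S` of linear maps `M → M'`: finitely many linearly independent vectors
can be sent to arbitrary vectors by an element of `S`. -/
def IsDenseHom {K M M' : Type*} [Ring K] [AddCommGroup M] [Module K M]
    [AddCommGroup M'] [Module K M'] (S : Set (M →ₗ[K] M')) : Prop :=
  ∀ (n : ℕ) (m : Fin n → M) (m' : Fin n → M'), LinearIndependent K m →
    ∃ f ∈ S, ∀ i, f (m i) = m' i

/-- The socle of a ring: the sum of all minimal right ideals. -/
def ringSocle (R : Type u) [Ring R] : Submodule Rᵐᵒᵖ R :=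
  sSup {I | IsAtom I}

/-- Strongly primitive algebras: the socle is nonzero and `R` is, up to isomorphism, a dense
subalgebra of `End_Δ(M)` for a right vector space `M` over a division PI-algebra `Δ`. -/
def IsStronglyPrimitiveAlgebra (Φ : Type w) [CommRing Φ] (R : Type u) [Ring R] [Algebra Φ R] :
    Prop :=
  ringSocle R ≠ ⊥ ∧
  ∃ (Δ : Type u) (_ : DivisionRing Δ) (_ : Algebra Φ Δ)
    (M : Type u) (_ : AddCommGroup M) (_ : Module Φ M) (_ : Module Δᵐᵒᵖ M)
    (_ : IsScalarTower Φ Δᵐᵒᵖ M),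
    IsPIAlgebra Φ Δ ∧
    ∃ h : R →ₐ[Φ] Module.End Δᵐᵒᵖ M, Function.Injective h ∧ IsDenseHom (Set.range h)

/-- Strongly primitive pairs: the socle is nonzero and `A` is, up to isomorphism, a dense subpair
of `(Hom_Δ(M⁻, M⁺), Hom_Δ(M⁺, M⁻))` for right vector spaces `M⁺`, `M⁻` over a division
PI-algebra `Δ`. -/
def AssociativePair.IsStronglyPrimitive {Φ : Type w} [CommRing Φ] {P : Type u} {N : Type v}
    [AddCommGroup P] [Module Φ P] [AddCommGroup N] [Module Φ N]
    (A : AssociativePair Φ P N) : Prop :=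
  (A.socPos ≠ ⊥ ∨ A.socNeg ≠ ⊥) ∧
  ∃ (Δ : Type (max u v)) (_ : DivisionRing Δ) (_ : Algebra Φ Δ)
    (Mp Mm : Type (max u v))
    (_ : AddCommGroup Mp) (_ : Module Φ Mp) (_ : Module Δᵐᵒᵖ Mp) (_ : IsScalarTower Φ Δᵐᵒᵖ Mp)
    (_ : AddCommGroup Mm) (_ : Module Φ Mm) (_ : Module Δᵐᵒᵖ Mm) (_ : IsScalarTower Φ Δᵐᵒᵖ Mm),
    IsPIAlgebra Φ Δ ∧
    ∃ h : A.Hom (AssociativePair.homPair Φ Δ Mp Mm),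
      Function.Injective h.toPos ∧ Function.Injective h.toNeg ∧
      IsDenseHom (Set.range h.toPos) ∧ IsDenseHom (Set.range h.toNeg)

/-! The division algebra `Δ` is the same on both sides, so the PI condition carries over unchanged;
what has to be moved is the dense faithful representation and the nonzero socle.

Representations: if `A` acts on `(M⁺, M⁻)`, then `E` acts on `M⁺ × M⁻` by block matrices. The
diagonal blocks exist because an element of `E₁₁` is built from products `xy`, which act as
compositions; faithfulness and density are checked block by block (`rep_injective`,
`isDenseHom_rep`). Conversely, if `E` acts on `M`, then `A⁺ = e₁Ee₂` and `A⁻ = e₂Ee₁` act between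
the Peirce components `e₁M` and `e₂M`, and density passes to corners (`isDenseHom_cornerHom`).

Socles: a ring with a dense faithful representation is prime, and for prime `E` the socle of `E` is
nonzero exactly when that of `A` is (`StandardImbedding.ringSocle_ne_bot_iff`). Primeness supplies
the nonzero products that move a generator of a minimal right ideal into or out of an off-diagonal
corner. -/

/-! ### Generators of minimal right ideals in a ring. -/

/-- A nonzero element `a` of a ring such that `aR` is a minimal right ideal. -/
def IsRightMinimalElement {R : Type*} [Ring R] (a : R) : Prop :=
  a ≠ 0 ∧ ∀ r, a * r ≠ 0 → ∃ s, a * r * s = a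

/-- Left multiplication by `b` is a map of right modules from the simple module `aR` onto `baR`. -/
theorem IsRightMinimalElement.mul_left {R : Type*} [Ring R] {a : R}
    (ha : IsRightMinimalElement a) (b : R) (hb : b * a ≠ 0) : IsRightMinimalElement (b * a) := by
  refine ⟨hb, fun r hr => ?_⟩
  obtain ⟨s, hs⟩ := ha.2 r fun h => hr (by rw [mul_assoc, h, mul_zero])
  exact ⟨s, by rw [mul_assoc b, mul_assoc b, hs]⟩

theorem IsRightMinimalElement.mul_right {R : Type*} [Ring R] {a : R}
    (ha : IsRightMinimalElement a) (b : R) (hb : a * b ≠ 0) : IsRightMinimalElement (a * b) := by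
  refine ⟨hb, fun r hr => ?_⟩
  obtain ⟨s, hs⟩ := ha.2 (b * r) (by rwa [← mul_assoc])
  exact ⟨s * b, by rw [← mul_assoc, mul_assoc a, hs]⟩

theorem IsRightMinimalElement.map {R S : Type*} [Ring R] [Ring S] (e : R ≃+* S) {a : R}
    (ha : IsRightMinimalElement a) : IsRightMinimalElement (e a) := by
  refine ⟨by simpa using ha.1, fun r hr => ?_⟩
  obtain ⟨s, hs⟩ := ha.2 (e.symm r) fun h => hr (by simpa using congrArg e h)
  exact ⟨e s, by simpa using congrArg e hs⟩

theorem exists_of_sSup_ne_bot {α : Type*} [CompleteLattice α] {s : Set α} (h : sSup s ≠ ⊥) :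
    s.Nonempty := by
  rw [Set.nonempty_iff_ne_empty]
  rintro rfl
  exact h sSup_empty

theorem ringSocle_ne_bot_iff {R : Type u} [Ring R] :
    ringSocle R ≠ ⊥ ↔ ∃ a : R, IsRightMinimalElement a := by
  constructor
  · intro h
    obtain ⟨I, hI⟩ := exists_of_sSup_ne_bot h
    have hI : IsAtom I := hI
    obtain ⟨a, haI, ha⟩ := (Submodule.ne_bot_iff I).1 hI.1
    refine ⟨a, ha, fun r hr => ?_⟩
    have hle : Submodule.span Rᵐᵒᵖ {a * r} ≤ I := by
      rw [Submodule.span_singleton_le_iff_mem]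
      exact I.smul_mem (MulOpposite.op r) haI
    have := (hI.le_iff.1 hle).resolve_left (by simpa using hr)
    rw [← this, Submodule.mem_span_singleton] at haI
    obtain ⟨s, hs⟩ := haI
    exact ⟨s.unop, hs⟩
  · rintro ⟨a, ha, hmin⟩ h
    have hat : IsAtom (Submodule.span Rᵐᵒᵖ {a}) := by
      refine ⟨by simpa using ha, fun J hJ => ?_⟩
      by_contra hne
      obtain ⟨b, hbJ, hb⟩ := (Submodule.ne_bot_iff J).1 hne
      obtain ⟨r, rfl⟩ := Submodule.mem_span_singleton.1 (hJ.le hbJ)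
      obtain ⟨s, hs⟩ := hmin r.unop hb
      refine hJ.not_ge ?_
      rw [Submodule.span_singleton_le_iff_mem, ← hs]
      exact J.smul_mem (MulOpposite.op s) hbJ
    have : Submodule.span Rᵐᵒᵖ {a} ≤ ringSocle R := le_sSup hat
    rw [h, le_bot_iff] at this
    exact hat.1 this

/-! ### The socle of a pair compared with the socle of its standard imbedding. -/

namespace AssociativePair

section Socle

variable {Φ : Type w} [CommRing Φ] {P : Type u} {N : Type v}
  [AddCommGroup P] [Module Φ P] [AddCommGroup N] [Module Φ N] (A : AssociativePair Φ P N)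

/-- `E₂₂` is generated as a unital algebra by the products `yz`, so right ideals of the pair in `A⁺`
are the right `E₂₂`-submodules. -/
theorem IsRightIdeal.ract_mem {A : AssociativePair Φ P N} {R : Submodule Φ P}
    (hR : A.IsRightIdeal R) {x : P} (hx : x ∈ R) (b : A.swap.diag) : A.swap.ract x b ∈ R := by
  refine A.swap.diag_induction (p := fun b => ∀ x ∈ R, b.2.unop x ∈ R) ?_ ?_ ?_ ?_ b x hx
  · exact fun y z x hx => hR x hx y z
  · intro r x hx
    simpa [Module.algebraMap_end_apply] using R.smul_mem r hx
  · intro a b ha hb x hx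
    simpa using R.add_mem (ha x hx) (hb x hx)
  · intro a b ha hb x hx
    simpa using hb _ (ha x hx)

/-- The right ideal of the pair `A` generated by an element of `A⁺`. -/
def ractRange (x : P) : Submodule Φ P where
  carrier := Set.range (A.swap.ract x)
  add_mem' := by
    rintro _ _ ⟨a, rfl⟩ ⟨b, rfl⟩
    exact ⟨a + b, A.swap.add_ract a b x⟩
  zero_mem' := ⟨0, A.swap.zero_ract x⟩
  smul_mem' := by
    rintro r _ ⟨a, rfl⟩
    exact ⟨r • a, A.swap.smul_ract r a x⟩

theorem isRightIdeal_ractRange (x : P) : A.IsRightIdeal (A.ractRange x) := by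
  rintro _ ⟨b, rfl⟩ y z
  exact ⟨b * A.swap.prod y z, A.swap.ract_mul _ _ x⟩

theorem mem_ractRange (x : P) : x ∈ A.ractRange x := ⟨1, A.swap.ract_one x⟩

/-- A nonzero element of `A⁺` that generates a minimal right ideal. -/
def IsRightMinimalElement (x : P) : Prop :=
  x ≠ 0 ∧ ∀ b, A.swap.ract x b ≠ 0 → ∃ c, A.swap.ract x (b * c) = x

theorem socPos_ne_bot_iff : A.socPos ≠ ⊥ ↔ ∃ x, A.IsRightMinimalElement x := by
  constructor
  · intro h
    obtain ⟨R, hR⟩ := exists_of_sSup_ne_bot h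
    have hR : A.IsMinimalRightIdeal R := hR
    obtain ⟨x, hxR, hx⟩ := (Submodule.ne_bot_iff R).1 hR.prop.2
    refine ⟨x, hx, fun b hb => ?_⟩
    have hle : A.ractRange (A.swap.ract x b) ≤ R := by
      rintro _ ⟨c, rfl⟩
      exact hR.prop.1.ract_mem (hR.prop.1.ract_mem hxR b) c
    have hge := hR.le_of_le ⟨A.isRightIdeal_ractRange _,
      (Submodule.ne_bot_iff _).2 ⟨_, A.mem_ractRange _, hb⟩⟩ hle
    obtain ⟨c, hc⟩ := hge hxR
    exact ⟨c, hc⟩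
  · rintro ⟨x, hx, hmin⟩ h
    have hat : A.IsMinimalRightIdeal (A.ractRange x) := by
      refine ⟨⟨A.isRightIdeal_ractRange _,
        (Submodule.ne_bot_iff _).2 ⟨x, A.mem_ractRange _, hx⟩⟩, ?_⟩
      rintro J ⟨hJ, hne⟩ hle
      obtain ⟨z, hzJ, hz⟩ := (Submodule.ne_bot_iff J).1 hne
      obtain ⟨b, rfl⟩ := hle hzJ
      obtain ⟨c, hc⟩ := hmin b hz
      have hxJ : x ∈ J := by
        rw [← hc]
        exact hJ.ract_mem hzJ c
      rintro _ ⟨d, rfl⟩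
      exact hJ.ract_mem hxJ d
    have : A.ractRange x ≤ A.socPos := le_sSup hat
    rw [h, le_bot_iff] at this
    exact hat.prop.2 this

/-- Exchanging the two diagonal idempotents of the standard imbedding. -/
def swapEquiv : A.StandardImbedding ≃+* A.swap.StandardImbedding where
  toFun a := ⟨a.c22, a.c21, a.c12, a.c11⟩
  invFun a := ⟨a.c22, a.c21, a.c12, a.c11⟩
  left_inv _ := rfl
  right_inv _ := rfl
  map_mul' a b := by
    refine StandardImbedding.ext ?_ ?_ ?_ ?_
    · exact add_comm _ _
    · exact add_comm _ _
    · exact add_comm _ _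
    · exact add_comm _ _
  map_add' _ _ := rfl

/-- A ring is prime if `aRb = 0` implies `a = 0` or `b = 0`. -/
def _root_.IsPrimeNoncommRing (R : Type*) [Ring R] : Prop :=
  ∀ a b : R, (∀ r, a * r * b = 0) → a = 0 ∨ b = 0

theorem _root_.IsPrimeNoncommRing.of_ringEquiv {R S : Type*} [Ring R] [Ring S] (e : R ≃+* S)
    (hR : IsPrimeNoncommRing R) : IsPrimeNoncommRing S := by
  intro a b h
  have := hR (e.symm a) (e.symm b) fun r => by simpa using congrArg e.symm (h (e r))
  simpa using this

namespace StandardImbedding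

variable {A}

/-- The linear embedding of `A⁺` into the standard imbedding. -/
def inPos : P →ₗ[Φ] A.StandardImbedding where
  toFun x := ⟨0, x, 0, 0⟩
  map_add' x y := by ext1 <;> simp
  map_smul' r x := by ext1 <;> simp

theorem inPos_injective : Function.Injective (inPos : P →ₗ[Φ] A.StandardImbedding) :=
  fun _ _ h => congrArg c12 h

/-- The embedding of `E₂₂` into the standard imbedding. -/
def in22 (b : A.swap.diag) : A.StandardImbedding := ⟨0, 0, 0, b⟩

theorem inPos_ne_zero {x : P} (hx : x ≠ 0) : (inPos x : A.StandardImbedding) ≠ 0 :=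
  (map_ne_zero_iff _ inPos_injective).2 hx

theorem inPos_mul_in22 (x : P) (b : A.swap.diag) :
    (inPos x * in22 b : A.StandardImbedding) = inPos (A.swap.ract x b) := by
  ext1 <;> simp [inPos, in22, prod_zero, lact_zero, ract_zero]

theorem inPos_mul_mul_inPos (x z : P) (s : A.StandardImbedding) :
    inPos x * s * inPos z = inPos (A.swap.ract x (A.swap.prod s.c21 z)) := by
  ext1 <;> simp [inPos, prod_zero, zero_prod, lact_zero, ract_zero, zero_ract, zero_lact,
    lact_prod]

/-- If `xr ≠ 0`, primeness gives `s` with `xrsx ≠ 0`. This element lies in `xEx ⊆ xE₂₂ ⊆ A⁺`, where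
minimality in the pair leads back to `x`. -/
theorem isRightMinimalElement_inPos (hE : IsPrimeNoncommRing A.StandardImbedding) {x : P}
    (hx : A.IsRightMinimalElement x) :
    _root_.IsRightMinimalElement (inPos x : A.StandardImbedding) := by
  refine ⟨inPos_ne_zero hx.1, fun r hr => ?_⟩
  by_contra! hs
  have : ∀ s, inPos x * r * s * inPos x = 0 := by
    intro s
    by_contra hne
    rw [mul_assoc (inPos x), inPos_mul_mul_inPos] at hne
    obtain ⟨c, hc⟩ := hx.2 _ fun h => hne (by rw [h, map_zero])
    refine hs (s * inPos x * in22 c) ?_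
    rw [← mul_assoc, ← mul_assoc, mul_assoc (inPos x), inPos_mul_mul_inPos, inPos_mul_in22,
      ← ract_mul, hc]
  exact (hE _ _ this).elim hr (inPos_ne_zero hx.1)

/-- For `a` in the first row and `p ≠ 0` in `A⁺`, primeness gives `asp ≠ 0`. This element is in `A⁺`
and still generates a minimal right ideal of `E`. -/
theorem exists_isRightMinimalElement_of_c11_c12 (hE : IsPrimeNoncommRing A.StandardImbedding)
    {a : A.StandardImbedding} (ha : _root_.IsRightMinimalElement a) (h21 : a.c21 = 0)
    (h22 : a.c22 = 0) : ∃ x, A.IsRightMinimalElement x := by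
  -- If `A⁺ = 0`, then `e₁Ee₂ = 0`, so `e₁` or `e₂` vanishes by primeness. Either way `A⁻ = 0`,
  -- hence `E₁₁ = 0`, contradicting `a ≠ 0`.
  have hP : ∃ p : P, p ≠ 0 := by
    by_contra! hP
    have h01 : (0 : A.diag) = 1 ∨ (0 : A.swap.diag) = 1 := by
      refine (hE ⟨1, 0, 0, 0⟩ ⟨0, 0, 0, 1⟩ fun r => ?_).imp ?_ ?_
      · ext1 <;> simp [hP, prod_zero, zero_prod, ract_zero, zero_lact]
      · exact fun h => (congrArg c11 h).symm
      · exact fun h => (congrArg c22 h).symm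
    have hN : ∀ n : N, n = 0 := by
      intro n
      rcases h01 with h | h
      · rw [← A.ract_one n, ← h, zero_ract]
      · rw [← A.swap.lact_one n, ← h, zero_lact]
    have hz : ∀ s : A.diag, s = 0 := by
      intro s
      refine Subtype.ext (Prod.ext ?_ (MulOpposite.unop_injective ?_))
      · ext x; exact hP _
      · ext x; exact hN _
    exact ha.1 (StandardImbedding.ext (hz _) (hP _) h21 h22)
  obtain ⟨p, hp⟩ := hP
  obtain ⟨s, hs⟩ : ∃ s, a * s * inPos p ≠ 0 := by
    by_contra! h
    exact (hE _ _ h).elim ha.1 (inPos_ne_zero hp)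
  have hX : a * s * inPos p = inPos (A.lact (a * s).c11 p) := by
    ext1 <;> simp [inPos, h21, h22, prod_zero, zero_prod, lact_zero, ract_zero, zero_ract,
      zero_lact]
  have hmin := ha.mul_right (s * inPos p) (by rwa [← mul_assoc])
  rw [← mul_assoc, hX] at hmin
  refine ⟨A.lact (a * s).c11 p, fun h => hmin.1 (by rw [h, map_zero]), fun b hb => ?_⟩
  obtain ⟨t, ht⟩ := hmin.2 (in22 b) (by rw [inPos_mul_in22]; exact inPos_ne_zero hb)
  rw [inPos_mul_in22] at ht
  -- Only the second row of `t` matters after an element of `A⁺`, and the `A⁺` entry of the product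
  -- sees just `t.c22`.
  refine ⟨t.c22, ?_⟩
  have := congrArg c12 ht
  simpa [inPos, zero_lact, ract_mul] using this

theorem ringSocle_ne_bot_iff (hE : IsPrimeNoncommRing A.StandardImbedding) :
    ringSocle A.StandardImbedding ≠ ⊥ ↔ A.socPos ≠ ⊥ ∨ A.socNeg ≠ ⊥ := by
  have hE' := hE.of_ringEquiv A.swapEquiv
  rw [_root_.ringSocle_ne_bot_iff, socNeg, socPos_ne_bot_iff, socPos_ne_bot_iff]
  constructor
  · rintro ⟨a, ha⟩
    -- Either `e₁a ≠ 0` is a minimal generator in the first row, or `a` lies in the second row and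
    -- the swapped pair applies.
    by_cases h : (⟨1, 0, 0, 0⟩ : A.StandardImbedding) * a = 0
    · right
      have h1 : a.c11 = 0 := by simpa [zero_prod] using congrArg c11 h
      have h2 : a.c12 = 0 := by simpa [ract_zero, lact_one] using congrArg c12 h
      exact exists_isRightMinimalElement_of_c11_c12 hE' (ha.map A.swapEquiv) h2 h1
    · left
      refine exists_isRightMinimalElement_of_c11_c12 hE (ha.mul_left _ h) ?_ ?_
      · simp [ract_zero, zero_lact]
      · simp [zero_prod]
  · rintro (⟨x, hx⟩ | ⟨x, hx⟩)
    · exact ⟨_, isRightMinimalElement_inPos hE hx⟩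
    · exact ⟨_, (isRightMinimalElement_inPos hE' hx).map A.swapEquiv.symm⟩

end StandardImbedding

end Socle

end AssociativePair

/-! ### Consequences and reformulations of density. -/

/-- Density moves a nonzero vector `bm` to any `m'`, so `aRb = 0` with `b ≠ 0` forces `am' = 0` for
all `m'`. -/
theorem IsPrimeNoncommRing.of_isDenseHom {K M R : Type*} [DivisionRing K] [AddCommGroup M] [Module K M]
    [Ring R] (h : R →+* Module.End K M) (hinj : Function.Injective h)
    (hd : IsDenseHom (Set.range h)) : IsPrimeNoncommRing R := by
  intro a b hab
  by_contra! hne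
  obtain ⟨m, hm⟩ : ∃ m, h b m ≠ 0 := by
    by_contra! hz
    exact hne.2 (hinj (by rw [map_zero]; exact LinearMap.ext hz))
  refine hne.1 (hinj ?_)
  rw [map_zero]
  ext m'
  obtain ⟨_, ⟨r, rfl⟩, hr⟩ := hd 1 (fun _ => h b m) (fun _ => m')
    (LinearIndependent.of_subsingleton 0 hm)
  calc h a m' = h a (h r (h b m)) := by rw [hr 0]
    _ = h (a * r * b) m := by simp
    _ = 0 := by rw [hab, map_zero, LinearMap.zero_apply]

section Density

variable {K M M' : Type*} [DivisionRing K] [AddCommGroup M] [Module K M]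
  [AddCommGroup M'] [Module K M']

/-- This basis-free form of density suits block matrices: the components of an independent family in
`M⁺ × M⁻` need not be independent, but projections of finite-dimensional subspaces stay
finite-dimensional. -/
theorem IsDenseHom.exists_eqOn {S : Set (M →ₗ[K] M')} (hS : IsDenseHom S) (g : M →ₗ[K] M')
    (V : Submodule K M) [FiniteDimensional K V] : ∃ f ∈ S, ∀ v ∈ V, f v = g v := by
  let b := Module.finBasis K V
  obtain ⟨f, hf, h⟩ := hS _ (fun i => (b i : M)) (fun i => g (b i))
    (b.linearIndependent.map' V.subtype V.ker_subtype)
  have : f ∘ₗ V.subtype = g ∘ₗ V.subtype := b.ext h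
  exact ⟨f, hf, fun v hv => LinearMap.congr_fun this ⟨v, hv⟩⟩

theorem isDenseHom_of_exists_eqOn {S : Set (M →ₗ[K] M')}
    (hS : ∀ (g : M →ₗ[K] M') (V : Submodule K M), FiniteDimensional K V →
      ∃ f ∈ S, ∀ v ∈ V, f v = g v) : IsDenseHom S := by
  intro n m m' hm
  -- The scalars of `constr` must commute with the action of the possibly noncommutative `K`; `ℕ`
  -- always does.
  obtain ⟨g, hg⟩ := LinearMap.exists_extend ((Module.Basis.span hm).constr ℕ m')
  obtain ⟨f, hf, h⟩ := hS g (Submodule.span K (Set.range m))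
    (FiniteDimensional.span_of_finite K (Set.finite_range m))
  refine ⟨f, hf, fun i => ?_⟩
  have hi : m i ∈ Submodule.span K (Set.range m) := Submodule.subset_span ⟨i, rfl⟩
  have h1 := LinearMap.congr_fun hg ⟨m i, hi⟩
  have h2 : (⟨m i, hi⟩ : Submodule.span K (Set.range m)) = Module.Basis.span hm i :=
    (Module.Basis.span_apply hm i).symm
  rw [h _ hi, ← (Module.Basis.constr_basis (Module.Basis.span hm) ℕ m' i), ← h2, ← h1]
  rfl

theorem IsDenseHom.exists_apply_eq {S : Set (M →ₗ[K] M')} (hS : IsDenseHom S) {m : M}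
    (hm : m ≠ 0) (m' : M') : ∃ f ∈ S, f m = m' := by
  obtain ⟨f, hf, h⟩ := hS 1 (fun _ => m) (fun _ => m') (LinearIndependent.of_subsingleton 0 hm)
  exact ⟨f, hf, h 0⟩

end Density

/-! ### From a dense representation of the pair to one of the standard imbedding. -/

namespace AssociativePair

section Representation

variable {Φ : Type w} [CommRing Φ] {P : Type u} {N : Type v}
  [AddCommGroup P] [Module Φ P] [AddCommGroup N] [Module Φ N] {A : AssociativePair Φ P N}
  {Δ : Type*} [DivisionRing Δ] [Algebra Φ Δ]
  {Mp Mm : Type _} [AddCommGroup Mp] [Module Φ Mp] [Module Δᵐᵒᵖ Mp] [IsScalarTower Φ Δᵐᵒᵖ Mp]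
  [AddCommGroup Mm] [Module Φ Mm] [Module Δᵐᵒᵖ Mm] [IsScalarTower Φ Δᵐᵒᵖ Mm]

/-- The homomorphism of the opposite pairs. -/
def Hom.swap (h : A.Hom (homPair Φ Δ Mp Mm)) : A.swap.Hom (homPair Φ Δ Mm Mp) where
  toPos := h.toNeg
  toNeg := h.toPos
  map_pos := h.map_neg
  map_neg := h.map_pos

/-- An endomorphism of `M⁺` representing an element of `E₁₁`. -/
def Hom.Represents (h : A.Hom (homPair Φ Δ Mp Mm)) (a : A.diag) (T : Module.End Δᵐᵒᵖ Mp) : Prop :=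
  (∀ z m, h.toPos (A.lact a z) m = T (h.toPos z m)) ∧
    ∀ w m, h.toNeg (A.ract w a) m = h.toNeg w (T m)

theorem Hom.map_pos_apply (h : A.Hom (homPair Φ Δ Mp Mm)) (x y z m) :
    h.toPos (A.pos x y z) m = h.toPos x (h.toNeg y (h.toPos z m)) := by
  rw [h.map_pos]; rfl

theorem Hom.map_neg_apply (h : A.Hom (homPair Φ Δ Mp Mm)) (x y z m) :
    h.toNeg (A.neg x y z) m = h.toNeg x (h.toPos y (h.toNeg z m)) := by
  rw [h.map_neg]; rfl

theorem Hom.represents_prod (h : A.Hom (homPair Φ Δ Mp Mm)) (x : P) (y : N) :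
    h.Represents (A.prod x y) (h.toPos x ∘ₗ h.toNeg y) :=
  ⟨fun z m => h.map_pos_apply x y z m, fun w m => h.map_neg_apply w x y m⟩

theorem Hom.Represents.add {h : A.Hom (homPair Φ Δ Mp Mm)} {a b : A.diag}
    {S T : Module.End Δᵐᵒᵖ Mp} (ha : h.Represents a S) (hb : h.Represents b T) :
    h.Represents (a + b) (S + T) :=
  ⟨fun z m => by simp [add_lact, ha.1, hb.1], fun w m => by simp [add_ract, ha.2, hb.2]⟩

theorem Hom.Represents.mul {h : A.Hom (homPair Φ Δ Mp Mm)} {a b : A.diag}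
    {S T : Module.End Δᵐᵒᵖ Mp} (ha : h.Represents a S) (hb : h.Represents b T) :
    h.Represents (a * b) (S * T) :=
  ⟨fun z m => by simp [lact_mul, ha.1, hb.1], fun w m => by simp [ract_mul, ha.2, hb.2]⟩

theorem Hom.Represents.smul {h : A.Hom (homPair Φ Δ Mp Mm)} {a : A.diag}
    {S : Module.End Δᵐᵒᵖ Mp} (r : Φ) (ha : h.Represents a S) :
    h.Represents (r • a) (r • S) :=
  ⟨fun z m => by simp [smul_lact, ha.1],
    fun w m => by simp [smul_ract, ha.2, LinearMap.map_smul_of_tower]⟩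

theorem Hom.represents_one (h : A.Hom (homPair Φ Δ Mp Mm)) : h.Represents 1 1 :=
  ⟨fun _ _ => rfl, fun _ _ => rfl⟩

theorem Hom.exists_represents (h : A.Hom (homPair Φ Δ Mp Mm)) (a : A.diag) :
    ∃ T, h.Represents a T := by
  obtain ⟨a, ha⟩ := a
  unfold diag at ha
  induction ha using Algebra.adjoin_induction with
  | mem x hx' =>
    obtain ⟨x, y, rfl⟩ := hx'
    exact ⟨_, h.represents_prod x y⟩
  | algebraMap r =>
    have := h.represents_one.smul r
    rw [← Algebra.algebraMap_eq_smul_one] at this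
    exact ⟨_, this⟩
  | add a b _ _ h1 h2 =>
    obtain ⟨S, hS⟩ := h1
    obtain ⟨T, hT⟩ := h2
    exact ⟨_, hS.add hT⟩
  | mul a b _ _ h1 h2 =>
    obtain ⟨S, hS⟩ := h1
    obtain ⟨T, hT⟩ := h2
    exact ⟨_, hS.mul hT⟩

/-- Dense representations of a pair on nonzero spaces. -/
structure Hom.IsDense (h : A.Hom (homPair Φ Δ Mp Mm)) : Prop where
  pos_dense : IsDenseHom (Set.range h.toPos)
  neg_dense : IsDenseHom (Set.range h.toNeg)
  exists_pos_ne_zero : ∃ m : Mp, m ≠ 0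
  exists_neg_ne_zero : ∃ m : Mm, m ≠ 0

namespace Hom.IsDense

variable {h : A.Hom (homPair Φ Δ Mp Mm)}

theorem swap (hd : h.IsDense) : h.swap.IsDense :=
  ⟨hd.neg_dense, hd.pos_dense, hd.exists_neg_ne_zero, hd.exists_pos_ne_zero⟩

/-- For a fixed `n ≠ 0` in `M⁻`, density makes every vector of `M⁺` of the form `zn` with `z ∈ A⁺`,
and there the action is prescribed. -/
theorem represents_unique (hd : h.IsDense) {a : A.diag} {S T : Module.End Δᵐᵒᵖ Mp}
    (hS : h.Represents a S) (hT : h.Represents a T) : S = T := by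
  obtain ⟨n, hn⟩ := hd.exists_neg_ne_zero
  ext m
  obtain ⟨_, ⟨z, rfl⟩, rfl⟩ := hd.pos_dense.exists_apply_eq hn m
  rw [← hS.1, ← hT.1]

/-- The representation of `E₁₁` on `M⁺`. -/
noncomputable def diagRep (hd : h.IsDense) : A.diag →ₐ[Φ] Module.End Δᵐᵒᵖ Mp :=
  have hs (a : A.diag) : h.Represents a (h.exists_represents a).choose :=
    (h.exists_represents a).choose_spec
  AlgHom.ofLinearMap
    { toFun := fun a => (h.exists_represents a).choose
      map_add' := fun a b => hd.represents_unique (hs _) ((hs a).add (hs b))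
      map_smul' := fun r a => hd.represents_unique (hs _) ((hs a).smul r) }
    (hd.represents_unique (hs _) h.represents_one)
    (fun a b => hd.represents_unique (hs _) ((hs a).mul (hs b)))

theorem represents_diagRep (hd : h.IsDense) (a : A.diag) : h.Represents a (hd.diagRep a) :=
  (h.exists_represents a).choose_spec

theorem diagRep_prod (hd : h.IsDense) (x : P) (y : N) :
    hd.diagRep (A.prod x y) = h.toPos x ∘ₗ h.toNeg y :=
  hd.represents_unique (hd.represents_diagRep _) (h.represents_prod x y)

/-- An element represented by `0` kills both `A⁺` and `A⁻`, and `E₁₁` is by construction faithful on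
these two together. -/
theorem diagRep_injective (hd : h.IsDense) (hp : Function.Injective h.toPos)
    (hn : Function.Injective h.toNeg) : Function.Injective hd.diagRep := by
  rw [injective_iff_map_eq_zero]
  intro a ha
  have hr := hd.represents_diagRep a
  rw [ha] at hr
  refine Subtype.ext (Prod.ext ?_ (MulOpposite.unop_injective ?_))
  · ext x
    refine hp ?_
    ext m
    simpa [lact] using hr.1 x m
  · ext y
    refine hn ?_
    ext m
    simpa [ract] using hr.2 y m

/-- Factor through one vector `n ≠ 0` of `M⁻`: for a basis `b` of `V`, take `yᵢ` sending `bⱼ` to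
`δᵢⱼ n` and `xᵢ` sending `n` to `g bᵢ`. Then `∑ xᵢyᵢ` agrees with `g` on `V`. -/
theorem exists_diagRep_eqOn (hd : h.IsDense) (g : Module.End Δᵐᵒᵖ Mp)
    (V : Submodule Δᵐᵒᵖ Mp) [FiniteDimensional Δᵐᵒᵖ V] :
    ∃ a : A.diag, ∀ v ∈ V, hd.diagRep a v = g v := by
  let b := Module.finBasis Δᵐᵒᵖ V
  obtain ⟨n, hn⟩ := hd.exists_neg_ne_zero
  have hy (i) : ∃ y, ∀ j, h.toNeg y (b j) = if j = i then n else 0 := by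
    obtain ⟨_, ⟨y, rfl⟩, hy⟩ := hd.neg_dense _ (fun j => (b j : Mp))
      (fun j => if j = i then n else 0) (b.linearIndependent.map' V.subtype V.ker_subtype)
    exact ⟨y, hy⟩
  have hx (i) : ∃ x, h.toPos x n = g (b i) := by
    obtain ⟨_, ⟨x, rfl⟩, hx⟩ := hd.pos_dense.exists_apply_eq hn (g (b i))
    exact ⟨x, hx⟩
  choose y hy using hy
  choose x hx using hx
  refine ⟨∑ i, A.prod (x i) (y i), fun v hv => ?_⟩
  have : hd.diagRep (∑ i, A.prod (x i) (y i)) ∘ₗ V.subtype = g ∘ₗ V.subtype := by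
    refine b.ext fun j => ?_
    simp only [map_sum, diagRep_prod, LinearMap.coe_comp, Function.comp_apply,
      Submodule.subtype_apply, LinearMap.sum_apply, hy, apply_ite, map_zero]
    simp [hx]
  exact LinearMap.congr_fun this ⟨v, hv⟩

/-- The representation of the standard imbedding on `M⁺ × M⁻`. -/
noncomputable def rep (hd : h.IsDense) : A.StandardImbedding →ₐ[Φ] Module.End Δᵐᵒᵖ (Mp × Mm) :=
  AlgHom.ofLinearMap
    { toFun := fun a => ((hd.diagRep a.c11).coprod (h.toPos a.c12)).prod
        ((h.toNeg a.c21).coprod (hd.swap.diagRep a.c22))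
      map_add' := fun a b => by
        refine LinearMap.ext fun m => Prod.ext ?_ ?_ <;> simp <;> abel
      map_smul' := fun r a => by
        refine LinearMap.ext fun m => Prod.ext ?_ ?_ <;> simp }
    (by refine LinearMap.ext fun m => Prod.ext ?_ ?_ <;> simp)
    (fun a b => by
      have h1 := (hd.represents_diagRep a.c11).1
      have h2 := (hd.represents_diagRep b.c11).2
      have h3 (z : N) (m : Mp) : h.toNeg (A.swap.lact a.c22 z) m =
          hd.swap.diagRep a.c22 (h.toNeg z m) := (hd.swap.represents_diagRep a.c22).1 z m
      have h4 (w : P) (m : Mm) : h.toPos (A.swap.ract w b.c22) m =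
          h.toPos w (hd.swap.diagRep b.c22 m) := (hd.swap.represents_diagRep b.c22).2 w m
      have h5 (m : Mm) : hd.swap.diagRep (A.swap.prod a.c21 b.c12) m =
          h.toNeg a.c21 (h.toPos b.c12 m) := by rw [diagRep_prod]; rfl
      refine LinearMap.ext fun m => Prod.ext ?_ ?_
      · simp [diagRep_prod, h1, h4]
        abel
      · simp [h5, h2, h3]
        abel)

theorem rep_apply (hd : h.IsDense) (a : A.StandardImbedding) (m : Mp × Mm) :
    hd.rep a m = (hd.diagRep a.c11 m.1 + h.toPos a.c12 m.2,
      h.toNeg a.c21 m.1 + hd.swap.diagRep a.c22 m.2) := rfl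

theorem rep_injective (hd : h.IsDense) (hp : Function.Injective h.toPos)
    (hn : Function.Injective h.toNeg) : Function.Injective hd.rep := by
  rw [injective_iff_map_eq_zero]
  intro a ha
  have h1 (m : Mp) := LinearMap.congr_fun ha (m, 0)
  have h2 (m : Mm) := LinearMap.congr_fun ha (0, m)
  simp only [rep_apply, map_zero, add_zero, zero_add, LinearMap.zero_apply, Prod.mk_eq_zero]
    at h1 h2
  refine StandardImbedding.ext ?_ (hp ?_) (hn ?_) ?_
  · refine hd.diagRep_injective hp hn ?_
    ext m
    simpa using (h1 m).1
  · ext m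
    simpa using (h2 m).1
  · ext m
    simpa using (h1 m).2
  · refine hd.swap.diagRep_injective hn hp ?_
    ext m
    simpa using (h2 m).2

theorem isDenseHom_rep (hd : h.IsDense) : IsDenseHom (Set.range hd.rep) := by
  refine isDenseHom_of_exists_eqOn fun g V hV => ?_
  -- The four blocks of `g` are matched independently, on subspaces with `V ⊆ V₁ × V₂`.
  let V₁ := V.map (LinearMap.fst Δᵐᵒᵖ Mp Mm)
  let V₂ := V.map (LinearMap.snd Δᵐᵒᵖ Mp Mm)
  obtain ⟨a, ha⟩ := hd.exists_diagRep_eqOn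
    (LinearMap.fst Δᵐᵒᵖ Mp Mm ∘ₗ g ∘ₗ LinearMap.inl Δᵐᵒᵖ Mp Mm) V₁
  obtain ⟨_, ⟨x, rfl⟩, hx⟩ := hd.pos_dense.exists_eqOn
    (LinearMap.fst Δᵐᵒᵖ Mp Mm ∘ₗ g ∘ₗ LinearMap.inr Δᵐᵒᵖ Mp Mm) V₂
  obtain ⟨_, ⟨y, rfl⟩, hy⟩ := hd.neg_dense.exists_eqOn
    (LinearMap.snd Δᵐᵒᵖ Mp Mm ∘ₗ g ∘ₗ LinearMap.inl Δᵐᵒᵖ Mp Mm) V₁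
  obtain ⟨b, hb⟩ := hd.swap.exists_diagRep_eqOn
    (LinearMap.snd Δᵐᵒᵖ Mp Mm ∘ₗ g ∘ₗ LinearMap.inr Δᵐᵒᵖ Mp Mm) V₂
  refine ⟨_, ⟨⟨a, x, y, b⟩, rfl⟩, fun v hv => ?_⟩
  have h1 : v.1 ∈ V₁ := ⟨v, hv, rfl⟩
  have h2 : v.2 ∈ V₂ := ⟨v, hv, rfl⟩
  have hv : v = (v.1, 0) + (0, v.2) := by simp
  rw [rep_apply, ha _ h1, hx _ h2, hy _ h1, hb _ h2]
  conv_rhs => rw [hv, map_add]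
  rfl

end Hom.IsDense

end Representation

theorem IsStronglyPrimitive.standardImbedding {Φ : Type w} [CommRing Φ] {P : Type u} {N : Type v}
    [AddCommGroup P] [Module Φ P] [AddCommGroup N] [Module Φ N]
    {A : AssociativePair Φ P N} (hA : A.IsStronglyPrimitive) :
    IsStronglyPrimitiveAlgebra Φ A.StandardImbedding := by
  obtain ⟨hsoc, Δ, _, _, Mp, Mm, _, _, _, _, _, _, _, _, hPI, h, hp, hn, hdp, hdn⟩ := hA
  -- A nonzero socle gives a nonzero element of `A⁺` or `A⁻`, hence a nonzero map between the two
  -- spaces, so neither is zero.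
  have hM : (∃ m : Mp, m ≠ 0) ∧ ∃ m : Mm, m ≠ 0 := by
    have hne : (∃ x : P, x ≠ 0) ∨ ∃ y : N, y ≠ 0 :=
      hsoc.imp (fun h => (A.socPos_ne_bot_iff.1 h).imp fun _ h => h.1)
        (fun h => (A.swap.socPos_ne_bot_iff.1 h).imp fun _ h => h.1)
    rcases hne with ⟨x, hx⟩ | ⟨y, hy⟩
    · obtain ⟨m, hm⟩ := DFunLike.ne_iff.1 ((map_ne_zero_iff _ hp).2 hx)
      exact ⟨⟨_, hm⟩, m, fun h => hm (by rw [h, map_zero, map_zero])⟩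
    · obtain ⟨m, hm⟩ := DFunLike.ne_iff.1 ((map_ne_zero_iff _ hn).2 hy)
      exact ⟨⟨m, fun h => hm (by rw [h, map_zero, map_zero])⟩, _, hm⟩
  have hd : h.IsDense := ⟨hdp, hdn, hM.1, hM.2⟩
  have hinj := hd.rep_injective hp hn
  have hE := IsPrimeNoncommRing.of_isDenseHom hd.rep.toRingHom hinj hd.isDenseHom_rep
  exact ⟨(StandardImbedding.ringSocle_ne_bot_iff hE).2 hsoc,
    Δ, inferInstance, inferInstance, Mp × Mm, inferInstance, inferInstance, inferInstance,
    inferInstance, hPI, hd.rep, hinj, hd.isDenseHom_rep⟩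

end AssociativePair

/-! ### From the standard imbedding back to the pair, through Peirce corners. -/

namespace AssociativePair

section Peirce

variable {Φ : Type w} [CommRing Φ] {P : Type u} {N : Type v}
  [AddCommGroup P] [Module Φ P] [AddCommGroup N] [Module Φ N] {A : AssociativePair Φ P N}

namespace StandardImbedding

/-- The linear embedding of `A⁻` into the standard imbedding. -/
def inNeg : N →ₗ[Φ] A.StandardImbedding where
  toFun y := ⟨0, 0, y, 0⟩
  map_add' x y := by ext1 <;> simp
  map_smul' r x := by ext1 <;> simp

/-- The first diagonal idempotent. -/
def e₁ : A.StandardImbedding := ⟨1, 0, 0, 0⟩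

/-- The second diagonal idempotent. -/
def e₂ : A.StandardImbedding := ⟨0, 0, 0, 1⟩

theorem inNeg_injective : Function.Injective (inNeg : N →ₗ[Φ] A.StandardImbedding) :=
  fun _ _ h => congrArg c21 h

theorem inPos_pos (x : P) (y : N) (z : P) :
    (inPos (A.pos x y z) : A.StandardImbedding) = inPos x * inNeg y * inPos z := by
  ext1 <;> simp [inPos, inNeg, prod_zero, zero_prod, lact_zero, zero_ract, zero_lact]
  rfl

theorem inNeg_neg (x : N) (y : P) (z : N) :
    (inNeg (A.neg x y z) : A.StandardImbedding) = inNeg x * inPos y * inNeg z := by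
  ext1 <;> simp [inPos, inNeg, prod_zero, zero_prod, lact_zero, zero_ract, zero_lact]
  rfl

theorem e₁_mul_mul_e₂ (a : A.StandardImbedding) : e₁ * a * e₂ = inPos a.c12 := by
  ext1 <;> simp [e₁, e₂, inPos, prod_zero, zero_prod, lact_zero, ract_zero, zero_ract, zero_lact,
    ract_one, lact_one]

theorem e₂_mul_mul_e₁ (a : A.StandardImbedding) : e₂ * a * e₁ = inNeg a.c21 := by
  ext1 <;> simp [e₁, e₂, inNeg, prod_zero, zero_prod, lact_zero, ract_zero, zero_ract, zero_lact,
    ract_one, lact_one]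

theorem e₁_mul_e₁ : (e₁ * e₁ : A.StandardImbedding) = e₁ := by
  ext1 <;> simp [e₁, prod_zero, lact_zero, ract_zero]

theorem e₂_mul_e₂ : (e₂ * e₂ : A.StandardImbedding) = e₂ := by
  ext1 <;> simp [e₂, prod_zero, lact_zero, ract_zero]

theorem e₁_mul_inPos (x : P) : (e₁ * inPos x : A.StandardImbedding) = inPos x := by
  ext1 <;> simp [e₁, inPos, prod_zero, zero_prod, lact_one, zero_ract, lact_zero]

theorem inPos_mul_e₂ (x : P) : (inPos x * e₂ : A.StandardImbedding) = inPos x := by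
  ext1 <;> simp [e₂, inPos, prod_zero, ract_one, zero_ract, lact_zero]

theorem e₂_mul_inNeg (y : N) : (e₂ * inNeg y : A.StandardImbedding) = inNeg y := by
  ext1 <;> simp [e₂, inNeg, prod_zero, zero_prod, lact_one, zero_ract, lact_zero]

theorem inNeg_mul_e₁ (y : N) : (inNeg y * e₁ : A.StandardImbedding) = inNeg y := by
  ext1 <;> simp [e₁, inNeg, prod_zero, ract_one, lact_zero, ract_zero]

end StandardImbedding

end Peirce

end AssociativePair

section Corner

variable {Φ : Type*} [CommRing Φ] {R : Type*} [Ring R] [Algebra Φ R] {L : Type*} [AddCommGroup L]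
  [Module Φ L] {Δ : Type*} [DivisionRing Δ] [Algebra Φ Δ]
  {M : Type*} [AddCommGroup M] [Module Φ M] [Module Δᵐᵒᵖ M] [IsScalarTower Φ Δᵐᵒᵖ M]

/-- The linear maps between the Peirce components `fM → eM` given by the elements `ι x` of a
corner `eRf`. -/
def cornerHom (h : R →ₐ[Φ] Module.End Δᵐᵒᵖ M) (ι : L →ₗ[Φ] R) (e f : R)
    (he : ∀ x, e * ι x = ι x) :
    L →ₗ[Φ] (LinearMap.range (h f) →ₗ[Δᵐᵒᵖ] LinearMap.range (h e)) where
  toFun x := (h (ι x)).restrict fun m _ => ⟨h (ι x) m, by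
    rw [← Module.End.mul_apply, ← map_mul, he]⟩
  map_add' x y := by
    refine LinearMap.ext fun m => Subtype.ext ?_
    simp only [LinearMap.restrict_apply, LinearMap.add_apply, map_add]
    rfl
  map_smul' r x := by
    refine LinearMap.ext fun m => Subtype.ext ?_
    simp only [LinearMap.restrict_apply, LinearMap.smul_apply, map_smul, RingHom.id_apply]
    rfl

theorem coe_cornerHom_apply (h : R →ₐ[Φ] Module.End Δᵐᵒᵖ M) (ι : L →ₗ[Φ] R) {e f : R}
    (he : ∀ x, e * ι x = ι x) (x : L) (m : LinearMap.range (h f)) :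
    (cornerHom h ι e f he x m : M) = h (ι x) m := rfl

theorem cornerHom_injective {h : R →ₐ[Φ] Module.End Δᵐᵒᵖ M} (hh : Function.Injective h)
    {ι : L →ₗ[Φ] R} (hι : Function.Injective ι) {e f : R} (he : ∀ x, e * ι x = ι x)
    (hf : ∀ x, ι x * f = ι x) : Function.Injective (cornerHom h ι e f he) := by
  intro x y hxy
  refine hι (hh ?_)
  ext m
  have := congrArg Subtype.val (LinearMap.congr_fun hxy ⟨h f m, m, rfl⟩)
  simpa only [coe_cornerHom_apply, ← Module.End.mul_apply, ← map_mul, hf] using this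

/-- If `r` sends independent vectors of `fM` to given vectors of `eM`, then so does `erf`, since `f`
and `e` act there as the identity. -/
theorem isDenseHom_cornerHom {h : R →ₐ[Φ] Module.End Δᵐᵒᵖ M} (hd : IsDenseHom (Set.range h))
    {ι : L →ₗ[Φ] R} {e f : R} (he : ∀ x, e * ι x = ι x) (hee : e * e = e) (hff : f * f = f)
    (hef : ∀ r, ∃ x, e * r * f = ι x) : IsDenseHom (Set.range (cornerHom h ι e f he)) := by
  have key {g : R} (hg : g * g = g) (m : LinearMap.range (h g)) : h g m = m := by
    obtain ⟨_, m, rfl⟩ := m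
    rw [← Module.End.mul_apply, ← map_mul, hg]
  intro n m m' hm
  obtain ⟨_, ⟨r, rfl⟩, hr⟩ := hd n (fun i => (m i : M)) (fun i => (m' i : M))
    (hm.map' (LinearMap.range (h f)).subtype (Submodule.ker_subtype _))
  obtain ⟨x, hx⟩ := hef r
  refine ⟨_, ⟨x, rfl⟩, fun i => Subtype.ext ?_⟩
  rw [coe_cornerHom_apply, ← hx, map_mul, map_mul, Module.End.mul_apply, Module.End.mul_apply,
    key hff, hr, key hee]

end Corner

namespace AssociativePair

open StandardImbedding

/-- The representation of the pair `A` on the Peirce components of a module over the standard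
imbedding. -/
def peirceHom {Φ : Type w} [CommRing Φ] {P : Type u} {N : Type v} [AddCommGroup P] [Module Φ P]
    [AddCommGroup N] [Module Φ N] {A : AssociativePair Φ P N}
    {Δ : Type*} [DivisionRing Δ] [Algebra Φ Δ] {M : Type _} [AddCommGroup M] [Module Φ M]
    [Module Δᵐᵒᵖ M] [IsScalarTower Φ Δᵐᵒᵖ M]
    (h : A.StandardImbedding →ₐ[Φ] Module.End Δᵐᵒᵖ M) :
    A.Hom (homPair Φ Δ (LinearMap.range (h e₁)) (LinearMap.range (h e₂))) where
  toPos := cornerHom h inPos e₁ e₂ e₁_mul_inPos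
  toNeg := cornerHom h inNeg e₂ e₁ e₂_mul_inNeg
  map_pos x y z := by
    refine LinearMap.ext fun m => Subtype.ext ?_
    rw [coe_cornerHom_apply, inPos_pos, map_mul, map_mul]
    rfl
  map_neg x y z := by
    refine LinearMap.ext fun m => Subtype.ext ?_
    rw [coe_cornerHom_apply, inNeg_neg, map_mul, map_mul]
    rfl

end AssociativePair

open AssociativePair AssociativePair.StandardImbedding in
theorem IsStronglyPrimitiveAlgebra.associativePair {Φ : Type w} [CommRing Φ] {P : Type u}
    {N : Type v} [AddCommGroup P] [Module Φ P] [AddCommGroup N] [Module Φ N]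
    {A : AssociativePair Φ P N} (hA : IsStronglyPrimitiveAlgebra Φ A.StandardImbedding) :
    A.IsStronglyPrimitive := by
  obtain ⟨hsoc, Δ, _, _, M, _, _, _, _, hPI, h, hinj, hd⟩ := hA
  have hE := IsPrimeNoncommRing.of_isDenseHom h.toRingHom hinj hd
  have hp : Function.Injective (peirceHom h).toPos :=
    cornerHom_injective hinj inPos_injective e₁_mul_inPos inPos_mul_e₂
  have hn : Function.Injective (peirceHom h).toNeg :=
    cornerHom_injective hinj inNeg_injective e₂_mul_inNeg inNeg_mul_e₁
  have hdp : IsDenseHom (Set.range (peirceHom h).toPos) :=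
    isDenseHom_cornerHom hd e₁_mul_inPos e₁_mul_e₁ e₂_mul_e₂ fun r => ⟨r.c12, e₁_mul_mul_e₂ r⟩
  have hdn : IsDenseHom (Set.range (peirceHom h).toNeg) :=
    isDenseHom_cornerHom hd e₂_mul_inNeg e₂_mul_e₂ e₁_mul_e₁ fun r => ⟨r.c21, e₂_mul_mul_e₁ r⟩
  exact ⟨(ringSocle_ne_bot_iff hE).1 hsoc, Δ, inferInstance, inferInstance,
    LinearMap.range (h e₁), LinearMap.range (h e₂), inferInstance, inferInstance, inferInstance,
    inferInstance, inferInstance, inferInstance, inferInstance, inferInstance, hPI,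
    peirceHom h, hp, hn, hdp, hdn⟩

theorem mainTheorem7 {Φ : Type w} [CommRing Φ] {P : Type u} {N : Type v}
    [AddCommGroup P] [Module Φ P] [AddCommGroup N] [Module Φ N]
    (A : AssociativePair Φ P N) :
    A.IsStronglyPrimitive ↔ IsStronglyPrimitiveAlgebra Φ A.StandardImbedding :=
  ⟨fun h => h.standardImbedding, fun h => h.associativePair⟩
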